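/- **Proposition (MI–Fisher relation).** Let $X$ be a random vector in $\mathbb R^n$ and, for each $t>0$, let $Y_t = X+Z_t$, where $Z_t\sim\mathcal N(\mathbf 0,t\mathbf I_n)$ is independent of $X$. Let $I(X;Y_t)\in[0,\infty]$ be the mutual information in nats, that is, the Kullback–Leibler divergence of the joint law of $(X,Y_t)$ from the product of the two marginal laws. For every $t>0$ the vector $Y_t$ has a unique continuous density $p_{Y_t}$ with respect to Lebesgue measure; it is strictly positive and continuously differentiable, and the Fisher information $$J(Y_t)=\mathbb E\bigl[\|\nabla\log p_{Y_t}(Y_t)\|^2\bigr]$$ is finite. Moreover: 1. If $I(X;Y_{t_0})<\infty$ for some $t_0>0$, then $I(X;Y_t)<\infty$ for all $t>0$, the function $t\mapsto I(X;Y_t)$ is differentiable on $(0,\infty)$, and for all $t>0$ $$\frac{d}{dt}I(X;Y_t)=\frac12 J(Y_t)-\frac{n}{2t}.$$ 2. If $\mathbb E\|X\|<\infty$, then $I(X;Y_t)<\infty$ for all $t>0$ (so that 1 applies), and $\mathrm{mmse}(t)=\mathbb E\bigl[\|X-\mathbb E[X\mid Y_t]\|^2\bigr]$ is finite and satisfies,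 for all $t>0$, $$\mathrm{mmse}(t)=nt-t^2J(Y_t).$$ -/

import Mathlib

open MeasureTheory ProbabilityTheory

noncomputable section

/-- `p` is a continuous probability density function (with respect to Lebesgue measure)
of the measure `ν` on `ℝⁿ`. -/
def IsContDensity {n : ℕ} (ν : Measure (EuclideanSpace ℝ (Fin n)))
    (p : EuclideanSpace ℝ (Fin n) → ℝ) : Prop :=
  Continuous p ∧ (∀ y, 0 ≤ p y) ∧ ν = volume.withDensity (fun y => ENNReal.ofReal (p y))

/-- A measure has at most one continuous density. -/
theorem IsContDensity.unique {n : ℕ} {ν : Measure (EuclideanSpace ℝ (Fin n))}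
    {p q : EuclideanSpace ℝ (Fin n) → ℝ} [IsFiniteMeasure ν]
    (hp : IsContDensity ν p) (hq : IsContDensity ν q) : p = q := by
  obtain ⟨hpc, hp0, hpν⟩ := hp
  obtain ⟨hqc, hq0, hqν⟩ := hq
  have hfin : ∫⁻ y, ENNReal.ofReal (p y) ≠ ⊤ := by
    have h1 : ν Set.univ ≠ ⊤ := measure_ne_top ν _
    rwa [hpν, withDensity_apply _ MeasurableSet.univ, Measure.restrict_univ] at h1
  have h := (withDensity_eq_iff (μ := volume) (by fun_prop) (by fun_prop) hfin).1
    (hpν.symm.trans hqν)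
  refine (hpc.ae_eq_iff_eq volume hqc).1 ?_
  filter_upwards [h] with y hy
  exact (ENNReal.ofReal_eq_ofReal_iff (hp0 y) (hq0 y)).1 hy

open Classical in
/-- The density `p_U` of a random vector `U` with law `ν`: the unique continuous density of `ν`
(and `0` if there is none). -/
def density {n : ℕ} (ν : Measure (EuclideanSpace ℝ (Fin n))) : EuclideanSpace ℝ (Fin n) → ℝ :=
  if h : ∃ p, IsContDensity ν p then h.choose else 0

/-- The score function `∇ log p_U`, in terms of the law `ν` of `U`. -/
def score {n : ℕ} (ν : Measure (EuclideanSpace ℝ (Fin n))) (y : EuclideanSpace ℝ (Fin n)) :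
    EuclideanSpace ℝ (Fin n) :=
  gradient (fun u => Real.log (density ν u)) y

/-- The Fisher information `J(U) = E ‖∇ log p_U(U)‖²` of a random vector `U`. -/
def fisherInfo {Ω : Type*} [MeasurableSpace Ω] {n : ℕ} (U : Ω → EuclideanSpace ℝ (Fin n))
    (P : Measure Ω) : ENNReal :=
  ∫⁻ y, ‖score (P.map U) y‖ₑ ^ 2 ∂(P.map U)

/-- The mutual information `I(X;Y)` in nats: the Kullback-Leibler divergence of the joint law of
`X` and `Y` from the product of their laws. -/
def mutualInfo {Ω A B : Type*} [MeasurableSpace Ω] [MeasurableSpace A] [MeasurableSpace B]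
    (X : Ω → A) (Y : Ω → B) (P : Measure Ω) : ENNReal :=
  InformationTheory.klDiv (P.map (fun ω => (X ω, Y ω))) ((P.map X).prod (P.map Y))

/-- The minimum mean-square error `E ‖X - E[X | Y]‖²`. -/
def mmse {Ω : Type*} [MeasurableSpace Ω] {n : ℕ} (X Y : Ω → EuclideanSpace ℝ (Fin n))
    (P : Measure Ω) : ENNReal :=
  ∫⁻ ω, ‖X ω - (P[X | MeasurableSpace.comap Y inferInstance]) ω‖ₑ ^ 2 ∂P

end

/-!
Up to an additive constant, `-log p_{Y_t}(y)` is the free energy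
`F_t(y) = -log E exp(-‖y - X‖²/2t)`, so that `I(X; Y_t) = E F_t(Y_t) - n/2`, and the score of `Y_t`
is `-E[Z_t | Y_t] / t`. Hence `t² J(Y_t)` is the second moment of `E[Z_t | Y_t]`. As
`X - E[X | Y_t] = -(Z_t - E[Z_t | Y_t])`, the MMSE relation is Pythagoras' theorem.

For the derivative of the information, couple all the channels as `Y_t = X + √t G` with one standard
Gaussian `G`, and differentiate `F_t(x + √t g)` at fixed `x` and `g`. The derivative is
`(⟪√t g, E[Z | Y]⟫ - E[‖Z‖² | Y]) / 2t²`, and its mean is `(E ‖E[Z | Y]‖² - n t) / 2t²`. It is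
dominated because `E[‖Z‖² | Y = y] ≤ 2t F_t(y)`, by Jensen's inequality for the posterior, and
`F_t(x + √t g) ≤ F_s(x + √s g) + ‖g‖²/2` for `s ≤ t`. The latter, with `F_s ≤ (t/s) F_t`, shows that
the information is finite for all `t` as soon as it is for one.
-/

noncomputable section

open Real Filter Topology InformationTheory
open scoped ENNReal

section Moments

variable {α F : Type*} [MeasurableSpace α] [NormedAddCommGroup F] {ν : Measure α} {f : α → F}

lemma lintegral_enorm_sq_eq_ofReal_integral (hf : Integrable (fun x => ‖f x‖ ^ 2) ν) :
    ∫⁻ x, ‖f x‖ₑ ^ 2 ∂ν = ENNReal.ofReal (∫ x, ‖f x‖ ^ 2 ∂ν) := by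
  rw [ofReal_integral_eq_lintegral_ofReal hf (ae_of_all _ fun x => by positivity)]
  congr with x
  rw [ENNReal.ofReal_pow (norm_nonneg _), ofReal_norm]

variable [InnerProductSpace ℝ F] {g : α → F}

lemma integrable_inner_of_memLp_two (hf : MemLp f 2 ν) (hg : MemLp g 2 ν) :
    Integrable (fun x => inner ℝ (f x) (g x)) ν :=
  memLp_one_iff_integrable.1 ((innerSL ℝ).memLp_of_bilin 1 hf hg)

lemma integral_sq_norm_sub (hf : MemLp f 2 ν) (hg : MemLp g 2 ν) :
    ∫ x, ‖f x - g x‖ ^ 2 ∂ν =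
      ∫ x, ‖f x‖ ^ 2 ∂ν - 2 * ∫ x, inner ℝ (f x) (g x) ∂ν + ∫ x, ‖g x‖ ^ 2 ∂ν := by
  have hfg := (integrable_inner_of_memLp_two hf hg).const_mul 2
  have hf₂ : Integrable (fun x => ‖f x‖ ^ 2) ν := hf.integrable_norm_pow two_ne_zero
  simp only [norm_sub_sq_real]
  rw [integral_add (by exact hf₂.sub hfg) (hg.integrable_norm_pow two_ne_zero),
    integral_sub hf₂ hfg, integral_const_mul]

variable [CompleteSpace F] [IsProbabilityMeasure ν]

lemma sq_norm_integral_le (hf : MemLp f 2 ν) : ‖∫ x, f x ∂ν‖ ^ 2 ≤ ∫ x, ‖f x‖ ^ 2 ∂ν := by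
  set m := ∫ x, f x ∂ν with hm
  have hinner : ∫ x, inner ℝ (f x) m ∂ν = ‖m‖ ^ 2 := by
    simp only [real_inner_comm m, integral_inner (hf.integrable one_le_two), ← hm,
      real_inner_self_eq_norm_sq]
  have hvar : 0 ≤ ∫ x, ‖f x - m‖ ^ 2 ∂ν := integral_nonneg fun _ => sq_nonneg _
  rw [integral_sq_norm_sub hf (memLp_const m), hinner, integral_const, probReal_univ,
    one_smul] at hvar
  linarith

end Moments

section FreeEnergy

variable {α : Type*} [MeasurableSpace α]

/-- The free energy `-log ∫ exp (-V) dμ` of the potential `V` under the reference measure `μ`, as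
in statistical mechanics. For a Gaussian channel with input law `μ` it is, up to an additive
constant, minus the logarithm of the output density. -/
def freeEnergy (μ : Measure α) (V : α → ℝ) : ℝ := -log (∫ x, rexp (-V x) ∂μ)

variable {μ : Measure α} {V W : α → ℝ}

lemma integrable_exp_neg_of_nonneg [IsFiniteMeasure μ] (hVm : AEMeasurable V μ)
    (hV : ∀ x, 0 ≤ V x) : Integrable (fun x => rexp (-V x)) μ := by
  refine (integrable_const (1 : ℝ)).mono' (by fun_prop) (ae_of_all _ fun x => ?_)
  rw [norm_of_nonneg (exp_pos _).le]
  exact exp_le_one_iff.2 (neg_nonpos.2 (hV x))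

lemma exp_neg_freeEnergy [NeZero μ] (hV : Integrable (fun x => rexp (-V x)) μ) :
    rexp (-freeEnergy μ V) = ∫ x, rexp (-V x) ∂μ := by
  rw [freeEnergy, neg_neg, exp_log (integral_exp_pos hV)]

lemma freeEnergy_le_add [NeZero μ] {c : ℝ} (hV : Integrable (fun x => rexp (-V x)) μ)
    (hW : Integrable (fun x => rexp (-W x)) μ) (h : ∀ x, V x ≤ W x + c) :
    freeEnergy μ V ≤ freeEnergy μ W + c := by
  have hle : rexp (-c) * ∫ x, rexp (-W x) ∂μ ≤ ∫ x, rexp (-V x) ∂μ := by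
    rw [← integral_const_mul]
    refine integral_mono (hW.const_mul _) hV fun x => ?_
    simp only [← exp_add, exp_le_exp]
    linarith [h x]
  rw [← exp_neg_freeEnergy hV, ← exp_neg_freeEnergy hW, ← exp_add, exp_le_exp] at hle
  linarith

variable [IsProbabilityMeasure μ]

lemma freeEnergy_nonneg (hV : ∀ x, 0 ≤ V x) : 0 ≤ freeEnergy μ V := by
  have hle : ∫ x, rexp (-V x) ∂μ ≤ ∫ _, 1 ∂μ :=
    integral_mono_of_nonneg (ae_of_all _ fun _ => (exp_pos _).le) (integrable_const 1)
      (ae_of_all _ fun x => exp_le_one_iff.2 (neg_nonpos.2 (hV x)))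
  refine neg_nonneg.2 (log_nonpos (integral_nonneg fun _ => (exp_pos _).le) ?_)
  simpa using hle

lemma freeEnergy_const_mul_le {c : ℝ} (hc : 1 ≤ c) (hV : Integrable (fun x => rexp (-V x)) μ)
    (hcV : Integrable (fun x => rexp (-(c * V x))) μ) :
    freeEnergy μ (fun x => c * V x) ≤ c * freeEnergy μ V := by
  have hrpow : ∀ x, rexp (-V x) ^ c = rexp (-(c * V x)) := fun x => by
    rw [← exp_mul, neg_mul, mul_comm]
  have hjensen : (∫ x, rexp (-V x) ∂μ) ^ c ≤ ∫ x, rexp (-V x) ^ c ∂μ :=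
    (convexOn_rpow hc).map_integral_le
      (continuousOn_id.rpow_const fun _ _ => Or.inr (zero_le_one.trans hc)) isClosed_Ici
      (ae_of_all _ fun _ => (exp_pos _).le) hV (by simpa only [Function.comp_def, hrpow] using hcV)
  simp only [hrpow] at hjensen
  rw [← exp_neg_freeEnergy hV, ← exp_neg_freeEnergy hcV, ← exp_mul, exp_le_exp] at hjensen
  linarith

lemma integral_tilted_le_freeEnergy (hV : Integrable (fun x => rexp (-V x)) μ)
    (hVi : Integrable V (μ.tilted fun x => -V x)) :
    ∫ x, V x ∂μ.tilted (fun x => -V x) ≤ freeEnergy μ V := by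
  have := isProbabilityMeasure_tilted hV
  have hexp : Integrable (fun x => rexp (V x)) (μ.tilted fun x => -V x) :=
    (integrable_tilted_iff hV _).2 (by simp [← exp_add])
  have hjensen := convexOn_exp.map_integral_le continuous_exp.continuousOn isClosed_univ
    (ae_of_all _ fun _ => Set.mem_univ _) hVi hexp
  have hnorm : ∫ x, rexp (V x) ∂μ.tilted (fun x => -V x) = rexp (freeEnergy μ V) := by
    rw [integral_exp_tilted, ← exp_neg_freeEnergy hV]
    simp [exp_neg]
  exact exp_le_exp.1 (hjensen.trans_eq hnorm)

end FreeEnergy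

section GaussianNoise

variable {E : Type*} [NormedAddCommGroup E] [InnerProductSpace ℝ E] [FiniteDimensional ℝ E]
  [MeasurableSpace E] [BorelSpace E] {t : ℝ}

variable (E) in
/-- The centered isotropic Gaussian law on `E` with covariance `t` times the identity: the law of
the noise of a Gaussian channel. For `t ≤ 0` it is the point mass at `0`. -/
def gaussianNoise (t : ℝ) : Measure E := (stdGaussian E).map fun z => √t • z

instance : IsProbabilityMeasure (gaussianNoise E t) :=
  Measure.isProbabilityMeasure_map (by fun_prop)

variable (E) in
/-- The Gaussian integral `∫ exp (-‖z‖² / 2t) dz`, equal to `(2πt) ^ (dim E / 2)`: the normalizing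
constant of the density of `gaussianNoise E t`. -/
def noiseNormalizer (t : ℝ) : ℝ := ∫ z : E, rexp (-(‖z‖ ^ 2 / (2 * t)))

lemma integrable_exp_neg_sq_norm_div (ht : 0 < t) :
    Integrable fun z : E => rexp (-(‖z‖ ^ 2 / (2 * t))) := by
  refine (GaussianFourier.integrable_cexp_neg_mul_sq_norm_add (V := E) (b := ((2 * t)⁻¹ : ℝ))
    (by simpa using ht) 0 0).norm.congr (ae_of_all _ fun z => ?_)
  simp only [Complex.norm_exp]
  congr 1
  simp [← Complex.ofReal_pow]
  ring

lemma noiseNormalizer_pos (ht : 0 < t) : 0 < noiseNormalizer E t :=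
  integral_exp_pos (integrable_exp_neg_sq_norm_div ht)

lemma charFun_gaussianNoise (ht : 0 ≤ t) (s : E) :
    charFun (gaussianNoise E t) s = Complex.exp (-(t * ‖s‖ ^ 2 / 2)) := by
  rw [gaussianNoise, charFun_map_smul, charFun_stdGaussian, norm_smul,
    norm_of_nonneg (sqrt_nonneg t)]
  push_cast
  rw [mul_pow, ← Complex.ofReal_pow (√t), sq_sqrt ht]
  ring_nf

lemma integral_exp_neg_sq_norm_div_mul_cexp_inner (ht : 0 < t) (s : E) :
    ∫ z : E, (rexp (-(‖z‖ ^ 2 / (2 * t))) : ℂ) * Complex.exp (inner ℝ z s * Complex.I) =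
      noiseNormalizer E t * Complex.exp (-(t * ‖s‖ ^ 2 / 2)) := by
  have hb : 0 < (((2 * t)⁻¹ : ℝ) : ℂ).re := by simpa using ht
  have hnormalizer := GaussianFourier.integral_cexp_neg_mul_sq_norm (V := E) hb
  have hfourier := GaussianFourier.integral_cexp_neg_mul_sq_norm_add (V := E) hb Complex.I s
  have : (t : ℂ) ≠ 0 := by exact_mod_cast ht.ne'
  rw [noiseNormalizer, ← integral_complex_ofReal]
  convert hfourier using 2
  · ext z
    rw [Complex.ofReal_exp, ← Complex.exp_add, real_inner_comm]
    push_cast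
    ring_nf
  · rw [← hnormalizer]
    congr with z
    push_cast
    ring_nf
  · rw [Complex.I_sq]
    push_cast
    field_simp
    ring_nf

lemma gaussianNoise_eq_withDensity (ht : 0 < t) :
    gaussianNoise E t = volume.withDensity fun z =>
      ENNReal.ofReal (rexp (-(‖z‖ ^ 2 / (2 * t))) / noiseNormalizer E t) := by
  have := isFiniteMeasure_withDensity_ofReal
    ((integrable_exp_neg_sq_norm_div (E := E) ht).div_const (noiseNormalizer E t)).2
  have hN : 0 < noiseNormalizer E t := noiseNormalizer_pos ht
  refine Measure.ext_of_charFun (funext fun s => ?_)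
  rw [charFun_gaussianNoise ht.le, charFun_apply,
    integral_withDensity_eq_integral_toReal_smul (by fun_prop) (by simp)]
  have hintegrand : ∀ z : E, (ENNReal.ofReal (rexp (-(‖z‖ ^ 2 / (2 * t))) /
      noiseNormalizer E t)).toReal • Complex.exp (inner ℝ z s * Complex.I) =
      (noiseNormalizer E t : ℂ)⁻¹ *
        ((rexp (-(‖z‖ ^ 2 / (2 * t))) : ℂ) * Complex.exp (inner ℝ z s * Complex.I)) := fun z => by
    rw [ENNReal.toReal_ofReal (by positivity), Complex.real_smul, Complex.ofReal_div,
      div_eq_inv_mul, mul_assoc]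
  simp only [hintegrand]
  rw [integral_const_mul, integral_exp_neg_sq_norm_div_mul_cexp_inner ht,
    inv_mul_cancel_left₀ (by exact_mod_cast hN.ne')]

lemma integrable_sq_norm_stdGaussian : Integrable (fun z : E => ‖z‖ ^ 2) (stdGaussian E) :=
  (IsGaussian.memLp_two_id (μ := stdGaussian E)).integrable_norm_pow two_ne_zero

lemma integral_sq_norm_stdGaussian :
    ∫ z : E, ‖z‖ ^ 2 ∂stdGaussian E = Module.finrank ℝ E := by
  let b := stdOrthonormalBasis ℝ E
  have hmemLp : ∀ i, MemLp (fun z : E => inner ℝ (b i) z) 2 (stdGaussian E) := fun i =>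
    (innerSL ℝ (b i)).comp_memLp' IsGaussian.memLp_two_id
  have hcoord : ∀ i, ∫ z : E, inner ℝ (b i) z ^ 2 ∂stdGaussian E = 1 := fun i => by
    have hvar := variance_dual_stdGaussian (innerSL ℝ (b i))
    rw [variance_of_integral_eq_zero (by fun_prop) (integral_strongDual_stdGaussian _)] at hvar
    simpa using hvar
  simp only [← b.sum_sq_inner_right]
  rw [integral_finsetSum _ fun i _ => (hmemLp i).integrable_sq]
  simp [hcoord]

lemma integrable_sq_norm_gaussianNoise :
    Integrable (fun z : E => ‖z‖ ^ 2) (gaussianNoise E t) := by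
  rw [gaussianNoise, integrable_map_measure (by fun_prop) (by fun_prop)]
  refine (integrable_sq_norm_stdGaussian.const_mul (√t ^ 2)).congr (ae_of_all _ fun z => ?_)
  simp [norm_smul, mul_pow]

lemma integral_sq_norm_gaussianNoise (ht : 0 ≤ t) :
    ∫ z : E, ‖z‖ ^ 2 ∂gaussianNoise E t = Module.finrank ℝ E * t := by
  rw [gaussianNoise, integral_map (by fun_prop) (by fun_prop)]
  simp only [norm_smul, mul_pow, norm_of_nonneg (sqrt_nonneg t), sq_sqrt ht]
  rw [integral_const_mul, integral_sq_norm_stdGaussian, mul_comm]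

lemma multivariateGaussian_zero_smul_one {ι : Type*} [Fintype ι] [DecidableEq ι] (ht : 0 ≤ t) :
    multivariateGaussian 0 (t • (1 : Matrix ι ι ℝ)) = gaussianNoise (EuclideanSpace ℝ ι) t := by
  refine Measure.ext_of_charFun (funext fun s => ?_)
  have hquad : s.ofLp ⬝ᵥ (t • (1 : Matrix ι ι ℝ)).mulVec s.ofLp = t * ‖s‖ ^ 2 := by
    rw [Matrix.smul_mulVec, Matrix.one_mulVec, dotProduct_smul, EuclideanSpace.real_norm_sq_eq,
      smul_eq_mul]
    simp [dotProduct, sq]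
  rw [charFun_multivariateGaussian (Matrix.PosSemidef.one.smul ht), charFun_gaussianNoise ht,
    hquad]
  simp

end GaussianNoise

section ProductDensities

variable {α G : Type*} [MeasurableSpace α] [MeasurableSpace G]

lemma snd_withDensity_prod (μ : Measure α) (ν : Measure G) [SFinite μ] [SFinite ν]
    {f : α × G → ℝ≥0∞} (hf : Measurable f) :
    ((μ.prod ν).withDensity f).snd = ν.withDensity fun y => ∫⁻ x, f (x, y) ∂μ := by
  refine Measure.ext_of_lintegral _ fun g hg => ?_
  have hg_snd : Measurable fun p : α × G => g p.2 := hg.comp measurable_snd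
  rw [Measure.snd, lintegral_map hg measurable_snd,
    lintegral_withDensity_eq_lintegral_mul _ hf hg_snd,
    lintegral_withDensity_eq_lintegral_mul _ hf.lintegral_prod_left' hg,
    lintegral_prod_symm _ (by fun_prop)]
  congr with y
  simp only [Pi.mul_apply]
  exact lintegral_mul_const _ (by fun_prop)

lemma map_prodMk_add_prod_withDensity [AddGroup G] [MeasurableAdd₂ G] [MeasurableNeg G]
    (μ ν : Measure G) [SFinite μ] [SFinite ν] [ν.IsAddLeftInvariant] {f : G → ℝ≥0∞}
    (hf : Measurable f) :
    (μ.prod (ν.withDensity f)).map (fun p => (p.1, p.1 + p.2)) =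
      (μ.prod ν).withDensity fun p => f (-p.1 + p.2) := by
  refine Measure.ext_of_lintegral _ fun g hg => ?_
  have hg_add : Measurable fun p : G × G => g (p.1, p.1 + p.2) := by fun_prop
  have hf_add : Measurable fun p : G × G => f (-p.1 + p.2) := by fun_prop
  have hf_snd : Measurable fun p : G × G => f p.2 := by fun_prop
  rw [prod_withDensity_right hf, lintegral_map hg (by fun_prop),
    lintegral_withDensity_eq_lintegral_mul _ hf_snd hg_add,
    lintegral_withDensity_eq_lintegral_mul _ hf_add hg]
  refine Eq.trans ?_ ((measurePreserving_prod_add μ ν).lintegral_comp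
    (f := fun p => f (-p.1 + p.2) * g p) (by fun_prop))
  simp

end ProductDensities

section ChannelEnergy

variable {E : Type*} [NormedAddCommGroup E]

/-- The potential `‖y - x‖² / 2t` of the Gaussian channel: up to an additive constant, minus the
logarithm of the density at the output `y` given the input `x`, for noise of variance `t`. -/
def channelEnergy (t : ℝ) (x y : E) : ℝ := ‖y - x‖ ^ 2 / (2 * t)

variable {t : ℝ} {x y : E}

lemma channelEnergy_nonneg (ht : 0 ≤ t) : 0 ≤ channelEnergy t x y := by
  unfold channelEnergy; positivity

lemma exp_neg_channelEnergy_le_one (ht : 0 ≤ t) : rexp (-channelEnergy t x y) ≤ 1 :=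
  exp_le_one_iff.2 (neg_nonpos.2 (channelEnergy_nonneg ht))

lemma sq_norm_sub_eq_mul_channelEnergy (ht : t ≠ 0) :
    ‖y - x‖ ^ 2 = 2 * t * channelEnergy t x y := by
  rw [channelEnergy]; field_simp

lemma exp_neg_channelEnergy_mul_sq_norm_le (ht : 0 < t) :
    rexp (-channelEnergy t x y) * ‖y - x‖ ^ 2 ≤ 2 * t := by
  have hle : rexp (-channelEnergy t x y) * channelEnergy t x y ≤ 1 := by
    rw [exp_neg, inv_mul_le_one₀ (exp_pos _)]
    linarith [add_one_le_exp (channelEnergy t x y)]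
  calc rexp (-channelEnergy t x y) * ‖y - x‖ ^ 2
      = 2 * t * (rexp (-channelEnergy t x y) * channelEnergy t x y) := by
        rw [sq_norm_sub_eq_mul_channelEnergy ht.ne']; ring
    _ ≤ 2 * t * 1 := by gcongr
    _ = 2 * t := mul_one _

lemma exp_neg_channelEnergy_mul_norm_le (ht : 0 < t) :
    rexp (-channelEnergy t x y) * ‖y - x‖ ≤ t + 1 / 2 := by
  have hsq := exp_neg_channelEnergy_mul_sq_norm_le (x := x) (y := y) ht
  have hone := exp_neg_channelEnergy_le_one (x := x) (y := y) ht.le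
  nlinarith [exp_pos (-channelEnergy t x y), sq_nonneg (‖y - x‖ - 1)]

lemma channelEnergy_eq_div_mul {s : ℝ} (hs : s ≠ 0) (ht : t ≠ 0) :
    channelEnergy s x y = t / s * channelEnergy t x y := by
  unfold channelEnergy; field_simp

variable {T : Type*} {f g : T → E}

@[fun_prop]
lemma continuous_channelEnergy [TopologicalSpace T] (hf : Continuous f) (hg : Continuous g) :
    Continuous fun p => channelEnergy t (f p) (g p) := by
  unfold channelEnergy; fun_prop

@[fun_prop]
lemma measurable_channelEnergy [MeasurableSpace E] [BorelSpace E] [SecondCountableTopology E]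
    [MeasurableSpace T] (hf : Measurable f) (hg : Measurable g) :
    Measurable fun p => channelEnergy t (f p) (g p) := by
  unfold channelEnergy; fun_prop

end ChannelEnergy

section OutputFreeEnergy

variable {E : Type*} [NormedAddCommGroup E] [MeasurableSpace E]

/-- The free energy of the channel potential under the input law `μ`, as a function of the output
`y`: up to an additive constant, minus the logarithm of the output density. -/
def outputFreeEnergy (μ : Measure E) (t : ℝ) (y : E) : ℝ :=
  freeEnergy μ fun x => channelEnergy t x y

variable {μ : Measure E} [IsProbabilityMeasure μ] {t : ℝ}

lemma outputFreeEnergy_nonneg (ht : 0 ≤ t) (y : E) : 0 ≤ outputFreeEnergy μ t y :=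
  freeEnergy_nonneg fun _ => channelEnergy_nonneg ht

variable [BorelSpace E] [SecondCountableTopology E]

lemma integrable_exp_neg_channelEnergy (ht : 0 ≤ t) (y : E) :
    Integrable (fun x => rexp (-channelEnergy t x y)) μ :=
  integrable_exp_neg_of_nonneg (by fun_prop) fun _ => channelEnergy_nonneg ht

lemma exp_neg_outputFreeEnergy (ht : 0 ≤ t) (y : E) :
    rexp (-outputFreeEnergy μ t y) = ∫ x, rexp (-channelEnergy t x y) ∂μ :=
  exp_neg_freeEnergy (integrable_exp_neg_channelEnergy ht y)

@[fun_prop]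
lemma measurable_outputFreeEnergy : Measurable (outputFreeEnergy μ t) := by
  have hint : StronglyMeasurable fun y => ∫ x, rexp (-channelEnergy t x y) ∂μ :=
    StronglyMeasurable.integral_prod_right
      (f := fun y x => rexp (-channelEnergy t x y)) (Measurable.stronglyMeasurable (by fun_prop))
  exact (measurable_log.comp hint.measurable).neg

end OutputFreeEnergy

section Channel

variable {E : Type*} [NormedAddCommGroup E] [InnerProductSpace ℝ E] [FiniteDimensional ℝ E]
  [MeasurableSpace E] [BorelSpace E]

/-- The joint law of the input and the output of the Gaussian channel with input law `μ` and noise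
of variance `t`. -/
def channelLaw (μ : Measure E) (t : ℝ) : Measure (E × E) :=
  (μ.prod (gaussianNoise E t)).map fun p => (p.1, p.1 + p.2)

/-- The law of the output of the Gaussian channel with input law `μ` and noise of variance `t`. -/
def outputLaw (μ : Measure E) (t : ℝ) : Measure E := (channelLaw μ t).snd

variable {μ : Measure E} [IsProbabilityMeasure μ] {t : ℝ}

instance : IsProbabilityMeasure (channelLaw μ t) :=
  Measure.isProbabilityMeasure_map (by fun_prop)

instance : IsProbabilityMeasure (outputLaw μ t) :=
  inferInstanceAs (IsProbabilityMeasure (channelLaw μ t).snd)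

lemma channelLaw_eq_withDensity_prod_volume (ht : 0 < t) :
    channelLaw μ t = (μ.prod volume).withDensity fun p =>
      ENNReal.ofReal (rexp (-channelEnergy t p.1 p.2) / noiseNormalizer E t) := by
  rw [channelLaw, gaussianNoise_eq_withDensity ht,
    map_prodMk_add_prod_withDensity _ _ (by fun_prop)]
  simp only [channelEnergy, neg_add_eq_sub]

lemma outputLaw_eq_withDensity (ht : 0 < t) :
    outputLaw μ t = volume.withDensity fun y =>
      ENNReal.ofReal (rexp (-outputFreeEnergy μ t y) / noiseNormalizer E t) := by
  have hN : 0 < noiseNormalizer E t := noiseNormalizer_pos ht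
  rw [outputLaw, channelLaw_eq_withDensity_prod_volume ht, snd_withDensity_prod _ _ (by fun_prop)]
  congr with y
  rw [exp_neg_outputFreeEnergy ht.le, ← integral_div, ofReal_integral_eq_lintegral_ofReal
    ((integrable_exp_neg_channelEnergy ht.le y).div_const _)
    (ae_of_all _ fun x => by positivity)]

lemma channelLaw_eq_withDensity_prod_outputLaw (ht : 0 < t) :
    channelLaw μ t = (μ.prod (outputLaw μ t)).withDensity fun p =>
      ENNReal.ofReal (rexp (outputFreeEnergy μ t p.2 - channelEnergy t p.1 p.2)) := by
  have hN : 0 < noiseNormalizer E t := noiseNormalizer_pos ht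
  rw [outputLaw_eq_withDensity ht, prod_withDensity_right (by fun_prop),
    ← withDensity_mul _ (by fun_prop) (by fun_prop), channelLaw_eq_withDensity_prod_volume ht]
  congr with p
  rw [Pi.mul_apply, ← ENNReal.ofReal_mul (by positivity), div_mul_eq_mul_div, ← exp_add,
    neg_add_eq_sub, sub_sub_cancel_left]

lemma integrable_outputLaw_iff {F : Type*} [NormedAddCommGroup F] [NormedSpace ℝ F] (ht : 0 < t)
    {f : E → F} : Integrable f (outputLaw μ t) ↔
      Integrable fun y => rexp (-outputFreeEnergy μ t y) • f y := by
  have hN : 0 < noiseNormalizer E t := noiseNormalizer_pos ht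
  rw [outputLaw_eq_withDensity ht,
    integrable_withDensity_iff_integrable_smul' (by fun_prop) (by simp),
    ← integrable_fun_smul_iff hN.ne' fun y => (ENNReal.ofReal _).toReal • f y]
  refine integrable_congr (ae_of_all _ fun y => ?_)
  simp only
  rw [ENNReal.toReal_ofReal (by positivity), smul_smul, mul_div_cancel₀ _ hN.ne']

end Channel

section Posterior

variable {E : Type*} [NormedAddCommGroup E] [MeasurableSpace E] [BorelSpace E]
  [SecondCountableTopology E]

/-- The conditional law of the input of the Gaussian channel with input law `μ` and noise of
variance `t`, given the output. -/
def inputPosterior (μ : Measure E) [IsProbabilityMeasure μ] (t : ℝ) : Kernel E E :=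
  (Kernel.const E μ).withDensity fun y x =>
    ENNReal.ofReal (rexp (outputFreeEnergy μ t y - channelEnergy t x y))

variable {μ : Measure E} [IsProbabilityMeasure μ] {t : ℝ}

lemma inputPosterior_eq_tilted (ht : 0 ≤ t) (y : E) :
    inputPosterior μ t y = μ.tilted fun x => -channelEnergy t x y := by
  rw [inputPosterior, Kernel.withDensity_apply _ (by fun_prop), Kernel.const_apply, Measure.tilted]
  simp only [← exp_neg_outputFreeEnergy ht, ← exp_sub, neg_sub_neg]

lemma isMarkovKernel_inputPosterior (ht : 0 ≤ t) : IsMarkovKernel (inputPosterior μ t) :=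
  ⟨fun y => by
    rw [inputPosterior_eq_tilted ht]
    exact isProbabilityMeasure_tilted (integrable_exp_neg_channelEnergy ht y)⟩

variable {F : Type*} [NormedAddCommGroup F] [NormedSpace ℝ F]

lemma integrable_inputPosterior_iff (ht : 0 ≤ t) {y : E} {h : E → F} :
    Integrable h (inputPosterior μ t y) ↔
      Integrable (fun x => rexp (-channelEnergy t x y) • h x) μ := by
  rw [inputPosterior_eq_tilted ht]
  exact integrable_tilted_iff (integrable_exp_neg_channelEnergy ht y) _

lemma integral_inputPosterior (ht : 0 ≤ t) (y : E) (h : E → F) :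
    ∫ x, h x ∂inputPosterior μ t y =
      rexp (outputFreeEnergy μ t y) • ∫ x, rexp (-channelEnergy t x y) • h x ∂μ := by
  rw [inputPosterior_eq_tilted ht, integral_tilted, ← integral_smul,
    ← exp_neg_outputFreeEnergy ht]
  simp only [smul_smul, exp_neg (outputFreeEnergy μ t y), div_inv_eq_mul, mul_comm]

lemma integral_exp_neg_channelEnergy_smul (ht : 0 ≤ t) (y : E) (h : E → F) :
    ∫ x, rexp (-channelEnergy t x y) • h x ∂μ =
      rexp (-outputFreeEnergy μ t y) • ∫ x, h x ∂inputPosterior μ t y := by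
  rw [integral_inputPosterior ht, smul_smul, ← exp_add, neg_add_cancel, exp_zero, one_smul]

end Posterior

section Disintegration

variable {E : Type*} [NormedAddCommGroup E] [InnerProductSpace ℝ E] [FiniteDimensional ℝ E]
  [MeasurableSpace E] [BorelSpace E] {μ : Measure E} [IsProbabilityMeasure μ] {t : ℝ}

lemma compProd_inputPosterior (ht : 0 < t) :
    outputLaw μ t ⊗ₘ inputPosterior μ t = (channelLaw μ t).map Prod.swap := by
  have := isMarkovKernel_inputPosterior (μ := μ) ht.le
  rw [inputPosterior] at this
  rw [inputPosterior, Measure.compProd_withDensity (by fun_prop), Measure.compProd_const,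
    channelLaw_eq_withDensity_prod_outputLaw ht]
  refine Measure.ext_of_lintegral _ fun g hg => ?_
  rw [lintegral_map hg measurable_swap, lintegral_withDensity_eq_lintegral_mul _ (by fun_prop) hg,
    lintegral_withDensity_eq_lintegral_mul _ (by fun_prop) (by fun_prop), ← lintegral_prod_swap]
  rfl

variable {F : Type*} [NormedAddCommGroup F]

lemma integrable_compProd_inputPosterior (ht : 0 < t) {h : E × E → F}
    (hh : Integrable h (channelLaw μ t)) :
    Integrable (fun p => h p.swap) (outputLaw μ t ⊗ₘ inputPosterior μ t) := by
  rw [compProd_inputPosterior ht]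
  exact (integrable_map_equiv MeasurableEquiv.prodComm _).2 hh

variable [NormedSpace ℝ F]

lemma integrable_integral_inputPosterior (ht : 0 < t) {h : E × E → F}
    (hh : Integrable h (channelLaw μ t)) :
    Integrable (fun y => ∫ x, h (x, y) ∂inputPosterior μ t y) (outputLaw μ t) := by
  have := isMarkovKernel_inputPosterior (μ := μ) ht.le
  exact (integrable_compProd_inputPosterior ht hh).integral_compProd

lemma integral_integral_inputPosterior (ht : 0 < t) {h : E × E → F}
    (hh : Integrable h (channelLaw μ t)) :
    ∫ y, ∫ x, h (x, y) ∂inputPosterior μ t y ∂outputLaw μ t = ∫ p, h p ∂channelLaw μ t := by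
  have := isMarkovKernel_inputPosterior (μ := μ) ht.le
  refine (Measure.integral_compProd (integrable_compProd_inputPosterior ht hh)).symm.trans ?_
  rw [compProd_inputPosterior ht]
  exact integral_map_equiv MeasurableEquiv.prodComm _

end Disintegration

section PosteriorNoise

variable {E : Type*} [NormedAddCommGroup E] [InnerProductSpace ℝ E] [FiniteDimensional ℝ E]
  [MeasurableSpace E] [BorelSpace E] {μ : Measure E} [IsProbabilityMeasure μ] {t : ℝ}

/-- The conditional mean `E[Z | Y = y]` of the noise `Z = Y - X`, given the output. -/
def noiseMean (μ : Measure E) [IsProbabilityMeasure μ] (t : ℝ) (y : E) : E :=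
  ∫ x, (y - x) ∂inputPosterior μ t y

/-- The conditional second moment `E[‖Z‖² | Y = y]` of the noise `Z = Y - X`, given the output. -/
def noiseSq (μ : Measure E) [IsProbabilityMeasure μ] (t : ℝ) (y : E) : ℝ :=
  ∫ x, ‖y - x‖ ^ 2 ∂inputPosterior μ t y

lemma memLp_sub_inputPosterior (ht : 0 < t) (y : E) :
    MemLp (fun x => y - x) 2 (inputPosterior μ t y) := by
  rw [memLp_two_iff_integrable_sq_norm (by fun_prop), integrable_inputPosterior_iff ht.le]
  refine (integrable_const (2 * t)).mono' (by fun_prop) (ae_of_all _ fun x => ?_)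
  rw [smul_eq_mul, norm_of_nonneg (by positivity)]
  exact exp_neg_channelEnergy_mul_sq_norm_le ht

lemma integrable_sub_inputPosterior (ht : 0 < t) (y : E) :
    Integrable (fun x => y - x) (inputPosterior μ t y) := by
  have := isMarkovKernel_inputPosterior (μ := μ) ht.le
  exact (memLp_sub_inputPosterior ht y).integrable one_le_two

lemma integral_id_inputPosterior (ht : 0 < t) (y : E) :
    ∫ x, x ∂inputPosterior μ t y = y - noiseMean μ t y := by
  have := isMarkovKernel_inputPosterior (μ := μ) ht.le
  calc ∫ x, x ∂inputPosterior μ t y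
      = ∫ x, (y - (y - x)) ∂inputPosterior μ t y := by simp only [sub_sub_cancel]
    _ = y - noiseMean μ t y := by
        rw [integral_sub (integrable_const y) (integrable_sub_inputPosterior ht y),
          integral_const, probReal_univ, one_smul, noiseMean]

lemma integrable_sq_norm_sub_inputPosterior (ht : 0 < t) (y : E) :
    Integrable (fun x => ‖y - x‖ ^ 2) (inputPosterior μ t y) :=
  (memLp_sub_inputPosterior ht y).integrable_norm_pow two_ne_zero

lemma measurable_noiseMean (ht : 0 ≤ t) : Measurable (noiseMean μ t) := by
  have := isMarkovKernel_inputPosterior (μ := μ) ht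
  exact (StronglyMeasurable.integral_kernel_prod_right' (κ := inputPosterior μ t)
    (f := fun p : E × E => p.1 - p.2) (Measurable.stronglyMeasurable (by fun_prop))).measurable

lemma measurable_noiseSq (ht : 0 ≤ t) : Measurable (noiseSq μ t) := by
  have := isMarkovKernel_inputPosterior (μ := μ) ht
  exact (StronglyMeasurable.integral_kernel_prod_right' (κ := inputPosterior μ t)
    (f := fun p : E × E => ‖p.1 - p.2‖ ^ 2)
    (Measurable.stronglyMeasurable (by fun_prop))).measurable

lemma sq_norm_noiseMean_le (ht : 0 < t) (y : E) : ‖noiseMean μ t y‖ ^ 2 ≤ noiseSq μ t y := by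
  have := isMarkovKernel_inputPosterior (μ := μ) ht.le
  exact sq_norm_integral_le (memLp_sub_inputPosterior ht y)

lemma noiseSq_le_outputFreeEnergy (ht : 0 < t) (y : E) :
    noiseSq μ t y ≤ 2 * t * outputFreeEnergy μ t y := by
  have hint : Integrable (fun x => channelEnergy t x y) (inputPosterior μ t y) :=
    (integrable_sq_norm_sub_inputPosterior ht y).div_const _
  rw [inputPosterior_eq_tilted ht.le] at hint
  simp only [noiseSq, sq_norm_sub_eq_mul_channelEnergy ht.ne', integral_const_mul,
    inputPosterior_eq_tilted ht.le]
  gcongr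
  exact integral_tilted_le_freeEnergy (integrable_exp_neg_channelEnergy ht.le y) hint

end PosteriorNoise

section NoiseMoments

variable {E : Type*} [NormedAddCommGroup E] [InnerProductSpace ℝ E] [FiniteDimensional ℝ E]
  [MeasurableSpace E] [BorelSpace E] {μ : Measure E} [IsProbabilityMeasure μ] {t : ℝ}

lemma channelLaw_map_sub : (channelLaw μ t).map (fun p => p.2 - p.1) = gaussianNoise E t := by
  rw [channelLaw, Measure.map_map (by fun_prop) (by fun_prop)]
  simp only [Function.comp_def, add_sub_cancel_left]
  exact Measure.snd_prod

lemma integrable_sq_norm_sub_channelLaw :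
    Integrable (fun p : E × E => ‖p.2 - p.1‖ ^ 2) (channelLaw μ t) := by
  have h := integrable_sq_norm_gaussianNoise (E := E) (t := t)
  rw [← channelLaw_map_sub (μ := μ)] at h
  exact h.comp_measurable (by fun_prop)

lemma memLp_sub_channelLaw : MemLp (fun p : E × E => p.2 - p.1) 2 (channelLaw μ t) :=
  (memLp_two_iff_integrable_sq_norm (by fun_prop)).2 integrable_sq_norm_sub_channelLaw

lemma integral_sq_norm_sub_channelLaw (ht : 0 ≤ t) :
    ∫ p, ‖p.2 - p.1‖ ^ 2 ∂channelLaw μ t = Module.finrank ℝ E * t := by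
  rw [← integral_sq_norm_gaussianNoise ht, ← channelLaw_map_sub (μ := μ),
    integral_map (by fun_prop) (by fun_prop)]

lemma integrable_noiseSq (ht : 0 < t) : Integrable (noiseSq μ t) (outputLaw μ t) :=
  integrable_integral_inputPosterior ht integrable_sq_norm_sub_channelLaw

lemma memLp_noiseMean (ht : 0 < t) : MemLp (noiseMean μ t) 2 (outputLaw μ t) := by
  have hm := measurable_noiseMean (μ := μ) ht.le
  rw [memLp_two_iff_integrable_sq_norm hm.aestronglyMeasurable]
  refine (integrable_noiseSq ht).mono' (by fun_prop) (ae_of_all _ fun y => ?_)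
  rw [norm_of_nonneg (sq_nonneg _)]
  exact sq_norm_noiseMean_le ht y

lemma integral_noiseSq (ht : 0 < t) :
    ∫ y, noiseSq μ t y ∂outputLaw μ t = Module.finrank ℝ E * t := by
  rw [← integral_sq_norm_sub_channelLaw (μ := μ) ht.le]
  exact integral_integral_inputPosterior ht integrable_sq_norm_sub_channelLaw

lemma memLp_noiseMean_snd (ht : 0 < t) :
    MemLp (fun p : E × E => noiseMean μ t p.2) 2 (channelLaw μ t) := by
  have hsnd : MeasurePreserving Prod.snd (channelLaw μ t) (outputLaw μ t) := ⟨measurable_snd, rfl⟩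
  exact (memLp_noiseMean (μ := μ) ht).comp_measurePreserving hsnd

lemma integrable_inner_sub_noiseMean (ht : 0 < t) :
    Integrable (fun p : E × E => inner ℝ (p.2 - p.1) (noiseMean μ t p.2)) (channelLaw μ t) :=
  integrable_inner_of_memLp_two memLp_sub_channelLaw (memLp_noiseMean_snd ht)

lemma integral_inner_sub_noiseMean (ht : 0 < t) :
    ∫ p, inner ℝ (p.2 - p.1) (noiseMean μ t p.2) ∂channelLaw μ t =
      ∫ y, ‖noiseMean μ t y‖ ^ 2 ∂outputLaw μ t := by
  rw [← integral_integral_inputPosterior ht (integrable_inner_sub_noiseMean ht)]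
  congr with y
  simp only [real_inner_comm (noiseMean μ t y)]
  rw [integral_inner (integrable_sub_inputPosterior ht y)]
  exact real_inner_self_eq_norm_sq _

lemma integral_sq_norm_sub_noiseMean (ht : 0 < t) :
    ∫ p, ‖p.2 - p.1 - noiseMean μ t p.2‖ ^ 2 ∂channelLaw μ t =
      Module.finrank ℝ E * t - ∫ y, ‖noiseMean μ t y‖ ^ 2 ∂outputLaw μ t := by
  have hm := measurable_noiseMean (μ := μ) ht.le
  have hmean : ∫ p, ‖noiseMean μ t p.2‖ ^ 2 ∂channelLaw μ t =
      ∫ y, ‖noiseMean μ t y‖ ^ 2 ∂outputLaw μ t := by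
    rw [outputLaw, Measure.snd, integral_map (by fun_prop) (by fun_prop)]
  rw [integral_sq_norm_sub memLp_sub_channelLaw (memLp_noiseMean_snd ht),
    integral_inner_sub_noiseMean ht, integral_sq_norm_sub_channelLaw ht.le, hmean]
  ring

end NoiseMoments

section MutualInformation

variable {E : Type*} [NormedAddCommGroup E] [InnerProductSpace ℝ E] [FiniteDimensional ℝ E]
  [MeasurableSpace E] [BorelSpace E] {μ : Measure E} [IsProbabilityMeasure μ] {t : ℝ}

lemma channelLaw_absolutelyContinuous (ht : 0 < t) :
    channelLaw μ t ≪ μ.prod (outputLaw μ t) := by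
  rw [channelLaw_eq_withDensity_prod_outputLaw ht]
  exact withDensity_absolutelyContinuous _ _

lemma llr_channelLaw (ht : 0 < t) :
    llr (channelLaw μ t) (μ.prod (outputLaw μ t)) =ᵐ[channelLaw μ t]
      fun p => outputFreeEnergy μ t p.2 - channelEnergy t p.1 p.2 := by
  have h := Measure.rnDeriv_withDensity (μ.prod (outputLaw μ t)) (f := fun p =>
    ENNReal.ofReal (rexp (outputFreeEnergy μ t p.2 - channelEnergy t p.1 p.2))) (by fun_prop)
  rw [← channelLaw_eq_withDensity_prod_outputLaw ht] at h
  filter_upwards [(channelLaw_absolutelyContinuous ht).ae_le h] with p hp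
  rw [llr, hp, ENNReal.toReal_ofReal (exp_pos _).le, log_exp]

lemma integrable_channelEnergy_channelLaw :
    Integrable (fun p : E × E => channelEnergy t p.1 p.2) (channelLaw μ t) :=
  integrable_sq_norm_sub_channelLaw.div_const _

lemma integral_channelEnergy_channelLaw (ht : 0 < t) :
    ∫ p, channelEnergy t p.1 p.2 ∂channelLaw μ t = Module.finrank ℝ E / 2 := by
  simp only [channelEnergy]
  rw [integral_div, integral_sq_norm_sub_channelLaw ht.le]
  field_simp

lemma integrable_outputFreeEnergy_snd_iff :
    Integrable (fun p : E × E => outputFreeEnergy μ t p.2) (channelLaw μ t) ↔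
      Integrable (outputFreeEnergy μ t) (outputLaw μ t) :=
  (integrable_map_measure measurable_outputFreeEnergy.aestronglyMeasurable
    measurable_snd.aemeasurable).symm

theorem klDiv_channelLaw_ne_top_iff (ht : 0 < t) :
    klDiv (channelLaw μ t) (μ.prod (outputLaw μ t)) ≠ ⊤ ↔
      Integrable (outputFreeEnergy μ t) (outputLaw μ t) := by
  have henergy := integrable_channelEnergy_channelLaw (μ := μ) (t := t)
  rw [klDiv_ne_top_iff, and_iff_right (channelLaw_absolutelyContinuous ht),
    integrable_congr (llr_channelLaw ht), ← integrable_outputFreeEnergy_snd_iff]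
  exact ⟨fun h => (h.add henergy).congr (ae_of_all _ fun p => sub_add_cancel _ _),
    fun h => h.sub henergy⟩

theorem toReal_klDiv_channelLaw (ht : 0 < t)
    (hF : Integrable (outputFreeEnergy μ t) (outputLaw μ t)) :
    (klDiv (channelLaw μ t) (μ.prod (outputLaw μ t))).toReal =
      ∫ y, outputFreeEnergy μ t y ∂outputLaw μ t - Module.finrank ℝ E / 2 := by
  rw [toReal_klDiv_of_measure_eq (channelLaw_absolutelyContinuous ht) (by simp),
    integral_congr_ae (llr_channelLaw ht),
    integral_sub (integrable_outputFreeEnergy_snd_iff.2 hF) integrable_channelEnergy_channelLaw,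
    integral_channelEnergy_channelLaw ht, outputLaw, Measure.snd,
    integral_map measurable_snd.aemeasurable measurable_outputFreeEnergy.aestronglyMeasurable]

end MutualInformation

section Coupling

variable {E : Type*} [NormedAddCommGroup E] [InnerProductSpace ℝ E]

lemma add_sqrt_smul_sub {t : ℝ} (ht : 0 < t) (x' x z : E) :
    x + √t • z - x' = √t • (z + (√t)⁻¹ • (x - x')) := by
  rw [smul_add, smul_inv_smul₀ (sqrt_pos.2 ht).ne', add_sub_right_comm, add_comm]

lemma channelEnergy_add_sqrt_smul {t : ℝ} (ht : 0 < t) (x' x z : E) :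
    channelEnergy t x' (x + √t • z) = ‖z + (√t)⁻¹ • (x - x')‖ ^ 2 / 2 := by
  rw [channelEnergy, add_sqrt_smul_sub ht, norm_smul, mul_pow, norm_of_nonneg (sqrt_nonneg t),
    sq_sqrt ht.le]
  field_simp

lemma sq_norm_add_smul_le {a b : ℝ} (ha : 0 ≤ a) (hab : a ≤ b) (z v : E) :
    ‖z + a • v‖ ^ 2 ≤ ‖z + b • v‖ ^ 2 + ‖z‖ ^ 2 := by
  have hexpand : ∀ c : ℝ, ‖z + c • v‖ ^ 2 = ‖z‖ ^ 2 + 2 * (c * inner ℝ z v) + c ^ 2 * ‖v‖ ^ 2 :=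
    fun c => by
      rw [norm_add_sq_real, norm_smul, inner_smul_right, mul_pow, norm_eq_abs, sq_abs]
  have hcross : 0 ≤ 2 * a * (b - a) * ‖v‖ ^ 2 := by
    have := sub_nonneg.2 hab
    positivity
  have hdiff := sq_nonneg ‖z + (b - a) • v‖
  rw [hexpand] at hdiff ⊢
  rw [hexpand]
  linarith

lemma channelEnergy_line_le {s t : ℝ} (hs : 0 < s) (hst : s ≤ t) (x' x z : E) :
    channelEnergy t x' (x + √t • z) ≤ channelEnergy s x' (x + √s • z) + ‖z‖ ^ 2 / 2 := by
  have ht := hs.trans_le hst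
  rw [channelEnergy_add_sqrt_smul ht, channelEnergy_add_sqrt_smul hs]
  have hinv : (√t)⁻¹ ≤ (√s)⁻¹ := inv_anti₀ (sqrt_pos.2 hs) (sqrt_le_sqrt hst)
  linarith [sq_norm_add_smul_le (inv_nonneg.2 (sqrt_nonneg t)) hinv z (x - x')]

variable [FiniteDimensional ℝ E] [MeasurableSpace E] [BorelSpace E] {μ : Measure E}

lemma channelLaw_eq_map_prod_stdGaussian [SFinite μ] (t : ℝ) :
    channelLaw μ t = (μ.prod (stdGaussian E)).map fun p => (p.1, p.1 + √t • p.2) := by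
  rw [channelLaw, gaussianNoise, ← Measure.map_id (μ := μ), Measure.map_prod_map _ _ (by fun_prop)
    (by fun_prop), Measure.map_map (by fun_prop) (by fun_prop), Measure.map_id]
  rfl

lemma outputLaw_eq_map_prod_stdGaussian [SFinite μ] (t : ℝ) :
    outputLaw μ t = (μ.prod (stdGaussian E)).map fun p => p.1 + √t • p.2 := by
  rw [outputLaw, channelLaw_eq_map_prod_stdGaussian, Measure.snd,
    Measure.map_map (by fun_prop) (by fun_prop)]
  rfl

end Coupling

section FreeEnergyIntegrability

variable {E : Type*} [NormedAddCommGroup E] [InnerProductSpace ℝ E] [FiniteDimensional ℝ E]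
  [MeasurableSpace E] [BorelSpace E] {μ : Measure E} [IsProbabilityMeasure μ] {s t : ℝ}

lemma outputFreeEnergy_line_le (hs : 0 < s) (hst : s ≤ t) (x z : E) :
    outputFreeEnergy μ t (x + √t • z) ≤ outputFreeEnergy μ s (x + √s • z) + ‖z‖ ^ 2 / 2 :=
  freeEnergy_le_add (integrable_exp_neg_channelEnergy (hs.le.trans hst) _)
    (integrable_exp_neg_channelEnergy hs.le _) fun x' => channelEnergy_line_le hs hst x' x z

lemma outputFreeEnergy_anti (hs : 0 < s) (hst : s ≤ t) (y : E) :
    outputFreeEnergy μ t y ≤ outputFreeEnergy μ s y := by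
  have ht := hs.trans_le hst
  have h := freeEnergy_le_add (c := 0) (integrable_exp_neg_channelEnergy (μ := μ) ht.le y)
    (integrable_exp_neg_channelEnergy hs.le y) fun x => ?_
  · rwa [add_zero] at h
  · rw [add_zero, channelEnergy, channelEnergy]
    gcongr

lemma outputFreeEnergy_le_div_mul (hs : 0 < s) (hst : s ≤ t) (y : E) :
    outputFreeEnergy μ s y ≤ t / s * outputFreeEnergy μ t y := by
  have ht := hs.trans_le hst
  have hscale : ∀ x, channelEnergy s x y = t / s * channelEnergy t x y := fun x =>
    channelEnergy_eq_div_mul hs.ne' ht.ne'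
  have hs_int := integrable_exp_neg_channelEnergy (μ := μ) hs.le y
  simp only [outputFreeEnergy, hscale] at hs_int ⊢
  exact freeEnergy_const_mul_le ((one_le_div hs).2 hst)
    (integrable_exp_neg_channelEnergy ht.le y) hs_int

lemma integrable_outputFreeEnergy_line_iff :
    Integrable (fun p : E × E => outputFreeEnergy μ t (p.1 + √t • p.2))
      (μ.prod (stdGaussian E)) ↔ Integrable (outputFreeEnergy μ t) (outputLaw μ t) := by
  rw [outputLaw_eq_map_prod_stdGaussian, integrable_map_measure (by fun_prop) (by fun_prop)]
  rfl

lemma integrable_outputFreeEnergy_of_le (hs : 0 < s) (hst : s ≤ t)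
    (h : Integrable (outputFreeEnergy μ s) (outputLaw μ s)) :
    Integrable (outputFreeEnergy μ t) (outputLaw μ t) := by
  rw [← integrable_outputFreeEnergy_line_iff] at h ⊢
  refine (h.add ((integrable_sq_norm_stdGaussian.comp_snd μ).div_const 2)).mono'
    (Measurable.aestronglyMeasurable (by fun_prop)) (ae_of_all _ fun p => ?_)
  rw [norm_of_nonneg (outputFreeEnergy_nonneg (hs.le.trans hst) _)]
  exact outputFreeEnergy_line_le hs hst p.1 p.2

lemma integrable_outputFreeEnergy_of_ge (hs : 0 < s) (hst : s ≤ t)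
    (h : Integrable (outputFreeEnergy μ t) (outputLaw μ t)) :
    Integrable (outputFreeEnergy μ s) (outputLaw μ s) := by
  have ht := hs.trans_le hst
  rw [integrable_outputLaw_iff ht] at h
  rw [integrable_outputLaw_iff hs]
  refine (h.const_mul (t / s)).mono' (by fun_prop) (ae_of_all _ fun y => ?_)
  have hFs := outputFreeEnergy_nonneg (μ := μ) hs.le y
  rw [smul_eq_mul, norm_of_nonneg (by positivity), smul_eq_mul, mul_left_comm]
  gcongr
  · exact outputFreeEnergy_anti hs hst y
  · exact outputFreeEnergy_le_div_mul hs hst y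

lemma integrable_outputFreeEnergy (hs : 0 < s) (ht : 0 < t)
    (h : Integrable (outputFreeEnergy μ s) (outputLaw μ s)) :
    Integrable (outputFreeEnergy μ t) (outputLaw μ t) :=
  (le_total s t).elim (fun hst => integrable_outputFreeEnergy_of_le hs hst h)
    fun hts => integrable_outputFreeEnergy_of_ge ht hts h

end FreeEnergyIntegrability

section EntropyDerivative

section Pointwise

variable {E : Type*} [NormedAddCommGroup E] [InnerProductSpace ℝ E]

lemma hasDerivAt_channelEnergy_line {s : ℝ} (hs : 0 < s) (x' x z : E) :
    HasDerivAt (fun r => channelEnergy r x' (x + √r • z))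
      ((inner ℝ (√s • z) (x + √s • z - x') - ‖x + √s • z - x'‖ ^ 2) / (2 * s ^ 2)) s := by
  have hline : HasDerivAt (fun r => x + √r • z - x') ((1 / (2 * √s)) • z) s :=
    (((hasDerivAt_sqrt hs.ne').smul_const z).const_add x).sub_const x'
  refine (hline.norm_sq.fun_div ((hasDerivAt_id s).const_mul 2) (by positivity)).congr_deriv ?_
  have hsqrt : √s * √s = s := mul_self_sqrt hs.le
  have := sqrt_pos.2 hs
  simp only [id, real_inner_smul_right, real_inner_smul_left, real_inner_comm z]
  field_simp
  linear_combination -inner ℝ z (x + √s • z - x') * hsqrt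

lemma abs_inner_sub_le {u v : E} {q : ℝ} (hq : ‖u‖ ^ 2 ≤ q) :
    |inner ℝ v u - q| ≤ 3 / 2 * q + ‖v‖ ^ 2 / 2 := by
  have hinner := abs_le.1 (abs_real_inner_le_norm v u)
  rw [abs_le]
  constructor <;> nlinarith [sq_nonneg (‖v‖ - ‖u‖)]

lemma norm_exp_neg_channelEnergy_mul_le {s : ℝ} (hs : 0 < s) (x y z : E) :
    ‖rexp (-channelEnergy s x y) *
        ((inner ℝ (√s • z) (y - x) - ‖y - x‖ ^ 2) / (2 * s ^ 2))‖ ≤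
      (3 + ‖z‖ ^ 2 / 2) / (2 * s) := by
  have hexp := exp_neg_channelEnergy_le_one (x := x) (y := y) hs.le
  have hsq := exp_neg_channelEnergy_mul_sq_norm_le (x := x) (y := y) hs
  have habs := abs_inner_sub_le (v := √s • z) (le_refl (‖y - x‖ ^ 2))
  rw [norm_smul, mul_pow, norm_of_nonneg (sqrt_nonneg s), sq_sqrt hs.le] at habs
  rw [norm_mul, norm_div, norm_of_nonneg (exp_pos _).le,
    norm_of_nonneg (by positivity : 0 ≤ 2 * s ^ 2), norm_eq_abs]
  calc rexp (-channelEnergy s x y) * (|inner ℝ (√s • z) (y - x) - ‖y - x‖ ^ 2| / (2 * s ^ 2))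
      ≤ rexp (-channelEnergy s x y) *
          ((3 / 2 * ‖y - x‖ ^ 2 + s * ‖z‖ ^ 2 / 2) / (2 * s ^ 2)) := by gcongr
    _ = (3 / 2 * (rexp (-channelEnergy s x y) * ‖y - x‖ ^ 2) +
          rexp (-channelEnergy s x y) * (s * ‖z‖ ^ 2 / 2)) / (2 * s ^ 2) := by ring
    _ ≤ (3 / 2 * (2 * s) + 1 * (s * ‖z‖ ^ 2 / 2)) / (2 * s ^ 2) := by gcongr
    _ = (3 + ‖z‖ ^ 2 / 2) / (2 * s) := by field_simp

end Pointwise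

variable {E : Type*} [NormedAddCommGroup E] [InnerProductSpace ℝ E] [FiniteDimensional ℝ E]
  [MeasurableSpace E] [BorelSpace E] {μ : Measure E} [IsProbabilityMeasure μ] {t : ℝ}

lemma integral_exp_neg_channelEnergy_mul_eq (ht : 0 < t) (v y : E) :
    ∫ x, rexp (-channelEnergy t x y) *
        ((inner ℝ v (y - x) - ‖y - x‖ ^ 2) / (2 * t ^ 2)) ∂μ =
      rexp (-outputFreeEnergy μ t y) *
        ((inner ℝ v (noiseMean μ t y) - noiseSq μ t y) / (2 * t ^ 2)) := by
  have hnoise := integrable_sub_inputPosterior (μ := μ) ht y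
  refine (integral_exp_neg_channelEnergy_smul ht.le y _).trans ?_
  rw [integral_div, integral_sub (hnoise.const_inner v)
    (integrable_sq_norm_sub_inputPosterior ht y), integral_inner hnoise]
  rfl

lemma hasDerivAt_exp_neg_outputFreeEnergy_line (ht : 0 < t) (x z : E) :
    HasDerivAt (fun s => rexp (-outputFreeEnergy μ s (x + √s • z)))
      (-(rexp (-outputFreeEnergy μ t (x + √t • z)) *
        ((inner ℝ (√t • z) (noiseMean μ t (x + √t • z)) - noiseSq μ t (x + √t • z)) /
          (2 * t ^ 2)))) t := by
  have hpos : ∀ s ∈ Set.Ioi (t / 2), 0 < s := fun s hs => (half_pos ht).trans hs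
  have hderiv := (hasDerivAt_integral_of_dominated_loc_of_deriv_le (μ := μ)
    (F := fun s x' => rexp (-channelEnergy s x' (x + √s • z)))
    (F' := fun s x' => -(rexp (-channelEnergy s x' (x + √s • z)) *
      ((inner ℝ (√s • z) (x + √s • z - x') - ‖x + √s • z - x'‖ ^ 2) / (2 * s ^ 2))))
    (bound := fun _ => (3 + ‖z‖ ^ 2 / 2) / t) (Ioi_mem_nhds (half_lt_self ht))
    (Eventually.of_forall fun s => by fun_prop) (integrable_exp_neg_channelEnergy ht.le _)
    (by fun_prop) (ae_of_all _ fun x' s hs => ?_) (integrable_const _)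
    (ae_of_all _ fun x' s hs => ?_)).2
  · rw [integral_neg, integral_exp_neg_channelEnergy_mul_eq ht] at hderiv
    refine hderiv.congr_of_eventuallyEq ?_
    filter_upwards [Ioi_mem_nhds ht] with s hs
    exact exp_neg_outputFreeEnergy hs.le _
  · rw [norm_neg]
    refine (norm_exp_neg_channelEnergy_mul_le (hpos s hs) _ _ _).trans ?_
    gcongr
    linarith [hs.out]
  · exact (hasDerivAt_channelEnergy_line (hpos s hs) x' x z).neg.exp.congr_deriv (mul_neg _ _)

lemma hasDerivAt_outputFreeEnergy_line (ht : 0 < t) (x z : E) :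
    HasDerivAt (fun s => outputFreeEnergy μ s (x + √s • z))
      ((inner ℝ (√t • z) (noiseMean μ t (x + √t • z)) - noiseSq μ t (x + √t • z)) /
        (2 * t ^ 2)) t := by
  have h := ((hasDerivAt_exp_neg_outputFreeEnergy_line (μ := μ) ht x z).log (exp_pos _).ne').neg
  simp only [log_exp] at h
  refine (h.congr_deriv ?_).congr_of_eventuallyEq (Eventually.of_forall fun s => ?_)
  · rw [neg_div, neg_neg, mul_div_cancel_left₀ _ (exp_pos _).ne']
  · simp

lemma abs_inner_noiseMean_sub_noiseSq_le (ht : 0 < t) (z y : E) :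
    |inner ℝ (√t • z) (noiseMean μ t y) - noiseSq μ t y| ≤
      t * (3 * outputFreeEnergy μ t y + ‖z‖ ^ 2 / 2) := by
  have habs := abs_inner_sub_le (v := √t • z) (sq_norm_noiseMean_le (μ := μ) ht y)
  rw [norm_smul, mul_pow, norm_of_nonneg (sqrt_nonneg t), sq_sqrt ht.le] at habs
  linarith [noiseSq_le_outputFreeEnergy (μ := μ) ht y]

lemma norm_deriv_outputFreeEnergy_line_le {s : ℝ} (ht : 0 < t) (hts : t ≤ s) (x z : E) :
    ‖(inner ℝ (√s • z) (noiseMean μ s (x + √s • z)) - noiseSq μ s (x + √s • z)) / (2 * s ^ 2)‖ ≤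
      (3 * outputFreeEnergy μ t (x + √t • z) + 2 * ‖z‖ ^ 2) / (2 * t) := by
  have hs := ht.trans_le hts
  have hF := outputFreeEnergy_nonneg (μ := μ) ht.le (x + √t • z)
  have hline := outputFreeEnergy_line_le (μ := μ) ht hts x z
  have habs := abs_inner_noiseMean_sub_noiseSq_le (μ := μ) hs z (x + √s • z)
  rw [norm_div, norm_of_nonneg (by positivity : 0 ≤ 2 * s ^ 2), norm_eq_abs]
  calc |inner ℝ (√s • z) (noiseMean μ s (x + √s • z)) - noiseSq μ s (x + √s • z)| / (2 * s ^ 2)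
      ≤ s * (3 * outputFreeEnergy μ t (x + √t • z) + 2 * ‖z‖ ^ 2) / (2 * s ^ 2) := by
        gcongr
        exact habs.trans (mul_le_mul_of_nonneg_left (by linarith) hs.le)
    _ = (3 * outputFreeEnergy μ t (x + √t • z) + 2 * ‖z‖ ^ 2) / (2 * s) := by field_simp
    _ ≤ (3 * outputFreeEnergy μ t (x + √t • z) + 2 * ‖z‖ ^ 2) / (2 * t) := by gcongr

lemma integral_inner_noiseMean_sub_noiseSq_line (ht : 0 < t) :
    ∫ p : E × E, (inner ℝ (√t • p.2) (noiseMean μ t (p.1 + √t • p.2)) -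
        noiseSq μ t (p.1 + √t • p.2)) ∂μ.prod (stdGaussian E) =
      ∫ y, ‖noiseMean μ t y‖ ^ 2 ∂outputLaw μ t - Module.finrank ℝ E * t := by
  have hmean := measurable_noiseMean (μ := μ) ht.le
  have hsq := measurable_noiseSq (μ := μ) ht.le
  have hsq_snd : ∫ p : E × E, noiseSq μ t p.2 ∂channelLaw μ t = ∫ y, noiseSq μ t y ∂outputLaw μ t :=
    (integral_map measurable_snd.aemeasurable hsq.aestronglyMeasurable).symm
  have hsq_int : Integrable (fun p : E × E => noiseSq μ t p.2) (channelLaw μ t) :=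
    (integrable_noiseSq ht).comp_measurable measurable_snd
  rw [← integral_noiseSq (μ := μ) ht, ← integral_inner_sub_noiseMean ht, ← hsq_snd,
    ← integral_sub (integrable_inner_sub_noiseMean ht) hsq_int, channelLaw_eq_map_prod_stdGaussian,
    integral_map (by fun_prop) (Measurable.aestronglyMeasurable (by fun_prop))]
  simp only [add_sub_cancel_left]

theorem hasDerivAt_integral_outputFreeEnergy (ht : 0 < t)
    (hF : Integrable (outputFreeEnergy μ t) (outputLaw μ t)) :
    HasDerivAt (fun s => ∫ y, outputFreeEnergy μ s y ∂outputLaw μ s)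
      ((∫ y, ‖noiseMean μ t y‖ ^ 2 ∂outputLaw μ t - Module.finrank ℝ E * t) / (2 * t ^ 2)) t := by
  have hpos : ∀ s ∈ Set.Ioi (t / 2), 0 < s := fun s hs => (half_pos ht).trans hs
  have hmean := measurable_noiseMean (μ := μ) ht.le
  have hsq := measurable_noiseSq (μ := μ) ht.le
  have hbound := ((((integrable_outputFreeEnergy_line_iff.2
    (integrable_outputFreeEnergy ht (half_pos ht) hF)).const_mul 3).add
    ((integrable_sq_norm_stdGaussian.comp_snd μ).const_mul 2)).div_const (2 * (t / 2)))
  have hderiv := (hasDerivAt_integral_of_dominated_loc_of_deriv_le (μ := μ.prod (stdGaussian E))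
    (F := fun s p => outputFreeEnergy μ s (p.1 + √s • p.2)) (F' := fun s p =>
      (inner ℝ (√s • p.2) (noiseMean μ s (p.1 + √s • p.2)) - noiseSq μ s (p.1 + √s • p.2)) /
        (2 * s ^ 2)) (Ioi_mem_nhds (half_lt_self ht))
    (Eventually.of_forall fun s => Measurable.aestronglyMeasurable (by fun_prop))
    (integrable_outputFreeEnergy_line_iff.2 hF) (Measurable.aestronglyMeasurable (by fun_prop))
    (bound := fun p =>
      (3 * outputFreeEnergy μ (t / 2) (p.1 + √(t / 2) • p.2) + 2 * ‖p.2‖ ^ 2) / (2 * (t / 2)))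
    (ae_of_all _ fun p s hs => ?_) (by exact hbound)
    (ae_of_all _ fun p s hs => hasDerivAt_outputFreeEnergy_line (hpos s hs) p.1 p.2)).2
  · rw [integral_div, integral_inner_noiseMean_sub_noiseSq_line ht] at hderiv
    refine hderiv.congr_of_eventuallyEq (Eventually.of_forall fun s => ?_)
    simp only
    rw [outputLaw_eq_map_prod_stdGaussian, integral_map (by fun_prop)
      measurable_outputFreeEnergy.aestronglyMeasurable]
  · exact norm_deriv_outputFreeEnergy_line_le (half_pos ht) hs.out.le p.1 p.2

end EntropyDerivative

section OutputDensity

section Pointwise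

variable {E : Type*} [NormedAddCommGroup E]

lemma norm_exp_neg_channelEnergy_smul_sub_le [NormedSpace ℝ E] {t : ℝ} (ht : 0 < t) (x y : E) :
    ‖rexp (-channelEnergy t x y) • (y - x)‖ ≤ t + 1 / 2 := by
  rw [norm_smul, norm_of_nonneg (exp_pos _).le]
  exact exp_neg_channelEnergy_mul_norm_le ht

lemma hasFDerivAt_exp_neg_channelEnergy [InnerProductSpace ℝ E] (t : ℝ) (x y : E) :
    HasFDerivAt (fun y => rexp (-channelEnergy t x y))
      (innerSL ℝ (-t⁻¹ • rexp (-channelEnergy t x y) • (y - x))) y := by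
  have h := (((hasFDerivAt_id y).sub_const x).norm_sq.mul_const (2 * t)⁻¹).neg.exp
  simp only [id, ← div_eq_mul_inv] at h
  refine h.congr_fderiv ?_
  ext v
  simp [channelEnergy]
  ring

end Pointwise

variable {E : Type*} [NormedAddCommGroup E] [InnerProductSpace ℝ E] [FiniteDimensional ℝ E]
  [MeasurableSpace E] [BorelSpace E] {μ : Measure E} [IsProbabilityMeasure μ] {t : ℝ}

lemma integral_exp_neg_channelEnergy_smul_sub (ht : 0 ≤ t) (y : E) :
    ∫ x, rexp (-channelEnergy t x y) • (y - x) ∂μ =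
      rexp (-outputFreeEnergy μ t y) • noiseMean μ t y :=
  integral_exp_neg_channelEnergy_smul ht y _

lemma hasFDerivAt_exp_neg_outputFreeEnergy (ht : 0 < t) (y : E) :
    HasFDerivAt (fun y => rexp (-outputFreeEnergy μ t y))
      (innerSL ℝ (-t⁻¹ • rexp (-outputFreeEnergy μ t y) • noiseMean μ t y)) y := by
  have h := hasFDerivAt_integral_of_dominated_of_fderiv_le (𝕜 := ℝ) (μ := μ) (s := Set.univ)
    (F := fun y x => rexp (-channelEnergy t x y))
    (F' := fun y x => innerSL ℝ (-t⁻¹ • rexp (-channelEnergy t x y) • (y - x)))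
    (x₀ := y) (bound := fun _ => t⁻¹ * (t + 1 / 2)) univ_mem
    (Eventually.of_forall fun y => by fun_prop) (integrable_exp_neg_channelEnergy ht.le y)
    (by fun_prop) (ae_of_all _ fun x y _ => ?_) (integrable_const _)
    (ae_of_all _ fun x y _ => hasFDerivAt_exp_neg_channelEnergy t x y)
  · have hint := (integrable_inputPosterior_iff ht.le).1
      (integrable_sub_inputPosterior (μ := μ) ht y)
    simp only [← exp_neg_outputFreeEnergy (μ := μ) ht.le] at h
    refine h.congr_fderiv ?_
    rw [← integral_exp_neg_channelEnergy_smul_sub ht.le, ← integral_smul]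
    exact (innerSL ℝ).integral_comp_comm (hint.smul (-t⁻¹))
  · rw [innerSL_apply_norm, norm_smul, norm_neg, norm_of_nonneg (inv_nonneg.2 ht.le)]
    gcongr
    exact norm_exp_neg_channelEnergy_smul_sub_le ht x y

lemma contDiff_exp_neg_outputFreeEnergy (ht : 0 < t) :
    ContDiff ℝ 1 fun y => rexp (-outputFreeEnergy μ t y) := by
  refine contDiff_one_iff_hasFDerivAt.2 ⟨_, ?_, hasFDerivAt_exp_neg_outputFreeEnergy ht⟩
  have hcont : Continuous fun y => ∫ x, rexp (-channelEnergy t x y) • (y - x) ∂μ :=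
    continuous_of_dominated (bound := fun _ => t + 1 / 2) (fun y => by fun_prop)
      (fun y => ae_of_all _ fun x => norm_exp_neg_channelEnergy_smul_sub_le ht x y)
      (integrable_const _) (ae_of_all _ fun x => by fun_prop)
  simp only [integral_exp_neg_channelEnergy_smul_sub ht.le] at hcont
  fun_prop

lemma hasGradientAt_outputFreeEnergy (ht : 0 < t) (y : E) :
    HasGradientAt (outputFreeEnergy μ t) (t⁻¹ • noiseMean μ t y) y := by
  have h := ((hasFDerivAt_exp_neg_outputFreeEnergy (μ := μ) ht y).log (exp_pos _).ne').fun_neg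
  simp only [log_exp, neg_neg] at h
  rw [hasGradientAt_iff_hasFDerivAt]
  refine h.congr_fderiv ?_
  ext v
  simp
  field_simp

end OutputDensity

section IntegrableInput

lemma exp_neg_mul_le {q : ℝ} (hq : 0 < q) (F : ℝ) : rexp (-F) * F ≤ q - rexp (-F) * log q := by
  have h : F + log q ≤ rexp F * q := by
    rw [← exp_log hq, ← exp_add, log_exp]
    linarith [add_one_le_exp (F + log q)]
  have h' := mul_le_mul_of_nonneg_left h (exp_pos (-F)).le
  rw [← mul_assoc, ← exp_add, neg_add_cancel, exp_zero, one_mul] at h'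
  linarith

variable {E : Type*} [NormedAddCommGroup E] [InnerProductSpace ℝ E] [FiniteDimensional ℝ E]
  [MeasurableSpace E] [BorelSpace E] {μ : Measure E} [IsProbabilityMeasure μ] {t : ℝ}

lemma integrable_norm_outputLaw (hμ : Integrable (fun x => x) μ) :
    Integrable (fun y => ‖y‖) (outputLaw μ t) := by
  rw [outputLaw_eq_map_prod_stdGaussian, integrable_map_measure (by fun_prop) (by fun_prop)]
  exact ((hμ.comp_fst (stdGaussian E)).add
    ((IsGaussian.integrable_fun_id.comp_snd μ).smul (√t))).norm

/- The inequality `exp_neg_mul_le` compares the output density with the integrable function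
`(1 + ‖y‖) ^ (-r)`, whose logarithm is of order `‖y‖`. -/
theorem integrable_outputFreeEnergy_of_integrable_id (ht : 0 < t)
    (hμ : Integrable (fun x => x) μ) :
    Integrable (outputFreeEnergy μ t) (outputLaw μ t) := by
  have hnorm := integrable_norm_outputLaw (t := t) hμ
  rw [integrable_outputLaw_iff ht] at hnorm ⊢
  set r : ℝ := Module.finrank ℝ E + 1 with hr
  have hdecay : Integrable fun y : E => (1 + ‖y‖) ^ (-r) :=
    integrable_one_add_norm (hr ▸ lt_add_one _)
  refine (hdecay.add (hnorm.const_mul r)).mono' (by fun_prop) (ae_of_all _ fun y => ?_)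
  have hy : 0 < 1 + ‖y‖ := by positivity
  have hlog : r * log (1 + ‖y‖) ≤ r * ‖y‖ := by
    gcongr
    linarith [log_le_sub_one_of_pos hy]
  have hF := exp_neg_mul_le (rpow_pos_of_pos hy (-r)) (outputFreeEnergy μ t y)
  rw [log_rpow hy] at hF
  rw [smul_eq_mul,
    norm_of_nonneg (mul_nonneg (exp_pos _).le (outputFreeEnergy_nonneg ht.le y))]
  calc rexp (-outputFreeEnergy μ t y) * outputFreeEnergy μ t y
      ≤ (1 + ‖y‖) ^ (-r) + rexp (-outputFreeEnergy μ t y) * (r * log (1 + ‖y‖)) := by linarith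
    _ ≤ (1 + ‖y‖) ^ (-r) + rexp (-outputFreeEnergy μ t y) * (r * ‖y‖) := by gcongr
    _ = _ := by simp only [Pi.add_apply, smul_eq_mul]; ring

end IntegrableInput

section GaussianChannel

variable {Ω : Type*} [MeasurableSpace Ω] {P : Measure Ω} {E : Type*} [NormedAddCommGroup E]
  [InnerProductSpace ℝ E] [FiniteDimensional ℝ E] [MeasurableSpace E]

/-- The random vectors `X` and `Y` are the input and the output of the Gaussian channel with input
law `μ` and noise of variance `t`. Only their joint law enters: the noise is `Y - X`. -/
structure IsGaussianChannel (P : Measure Ω) (X Y : Ω → E) (μ : Measure E) (t : ℝ) : Prop where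
  measurable_input : Measurable X
  measurable_output : Measurable Y
  map_prodMk : P.map (fun ω => (X ω, Y ω)) = channelLaw μ t

variable {X Y Z : Ω → E} {μ : Measure E} {t : ℝ}

namespace IsGaussianChannel

lemma map_output (h : IsGaussianChannel P X Y μ t) : P.map Y = outputLaw μ t := by
  rw [outputLaw, ← h.map_prodMk, Measure.snd_map_prodMk h.measurable_input]

end IsGaussianChannel

variable [BorelSpace E]

lemma isGaussianChannel_of_indepFun [IsProbabilityMeasure P] (hX : Measurable X)
    (hZ : Measurable Z) (hZlaw : P.map Z = gaussianNoise E t) (hind : IndepFun X Z P)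
    (hY : ∀ ω, Y ω = X ω + Z ω) : IsGaussianChannel P X Y (P.map X) t := by
  obtain rfl : Y = fun ω => X ω + Z ω := funext hY
  refine ⟨hX, hX.add hZ, ?_⟩
  have hXZ := (indepFun_iff_map_prod_eq_prod_map_map hX.aemeasurable hZ.aemeasurable).1 hind
  rw [channelLaw, ← hZlaw, ← hXZ, Measure.map_map (by fun_prop) (by fun_prop)]
  rfl

namespace IsGaussianChannel

lemma map_input (h : IsGaussianChannel P X Y μ t) : P.map X = μ := by
  rw [← Measure.fst_map_prodMk h.measurable_output, h.map_prodMk, channelLaw,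
    Measure.fst_map_prodMk (by fun_prop)]
  exact Measure.fst_prod

lemma mutualInfo_eq_klDiv (h : IsGaussianChannel P X Y μ t) :
    mutualInfo X Y P = klDiv (channelLaw μ t) (μ.prod (outputLaw μ t)) := by
  rw [mutualInfo, h.map_prodMk, h.map_input, h.map_output]

variable [IsProbabilityMeasure μ]

lemma mutualInfo_ne_top_iff (h : IsGaussianChannel P X Y μ t) (ht : 0 < t) :
    mutualInfo X Y P ≠ ⊤ ↔ Integrable (outputFreeEnergy μ t) (outputLaw μ t) := by
  rw [h.mutualInfo_eq_klDiv, klDiv_channelLaw_ne_top_iff ht]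

lemma mutualInfo_ne_top_of_integrable (h : IsGaussianChannel P X Y μ t) (ht : 0 < t)
    (hX : Integrable X P) : mutualInfo X Y P ≠ ⊤ := by
  refine (h.mutualInfo_ne_top_iff ht).2 (integrable_outputFreeEnergy_of_integrable_id ht ?_)
  rw [← h.map_input]
  exact (integrable_map_measure (by fun_prop) h.measurable_input.aemeasurable).2 hX

theorem hasDerivAt_mutualInfo {Y : ℝ → Ω → E} (h : ∀ s, 0 < s → IsGaussianChannel P X (Y s) μ s)
    (ht : 0 < t) (hI : mutualInfo X (Y t) P ≠ ⊤) :
    HasDerivAt (fun s => (mutualInfo X (Y s) P).toReal)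
      ((∫ y, ‖noiseMean μ t y‖ ^ 2 ∂outputLaw μ t - Module.finrank ℝ E * t) / (2 * t ^ 2)) t := by
  have hF := ((h t ht).mutualInfo_ne_top_iff ht).1 hI
  have hderiv := (hasDerivAt_integral_outputFreeEnergy ht hF).sub_const (Module.finrank ℝ E / 2 : ℝ)
  refine hderiv.congr_of_eventuallyEq ?_
  filter_upwards [Ioi_mem_nhds ht] with s hs
  rw [(h s hs).mutualInfo_eq_klDiv,
    toReal_klDiv_channelLaw hs (integrable_outputFreeEnergy ht hs hF)]

theorem condExp_ae_eq [IsFiniteMeasure P] (h : IsGaussianChannel P X Y μ t) (ht : 0 < t)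
    (hX : Integrable X P) :
    P[X | MeasurableSpace.comap Y inferInstance] =ᵐ[P] fun ω => Y ω - noiseMean μ t (Y ω) := by
  have := isMarkovKernel_inputPosterior (μ := μ) ht.le
  have hdisint : P.map (fun ω => (Y ω, X ω)) = P.map Y ⊗ₘ inputPosterior μ t := by
    rw [h.map_output, compProd_inputPosterior ht, ← h.map_prodMk,
      Measure.map_map measurable_swap (h.measurable_input.prodMk h.measurable_output)]
    rfl
  have hcond := condDistrib_ae_eq_of_measure_eq_compProd Y hX.1.aemeasurable hdisint
  filter_upwards [condExp_ae_eq_integral_condDistrib' h.measurable_output hX,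
    ae_of_ae_map h.measurable_output.aemeasurable hcond] with ω hω hpost
  rw [hω, hpost, integral_id_inputPosterior ht]

end IsGaussianChannel

end GaussianChannel

section FisherInformation

variable {n : ℕ}

lemma IsContDensity.density_eq {ν : Measure (EuclideanSpace ℝ (Fin n))} [IsFiniteMeasure ν]
    {p : EuclideanSpace ℝ (Fin n) → ℝ} (hp : IsContDensity ν p) : density ν = p := by
  have h : ∃ p, IsContDensity ν p := ⟨p, hp⟩
  rw [density, dif_pos h]
  exact h.choose_spec.unique hp

variable {μ : Measure (EuclideanSpace ℝ (Fin n))} [IsProbabilityMeasure μ] {t : ℝ}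

lemma isContDensity_outputLaw (ht : 0 < t) :
    IsContDensity (outputLaw μ t) fun y =>
      rexp (-outputFreeEnergy μ t y) / noiseNormalizer (EuclideanSpace ℝ (Fin n)) t :=
  ⟨(contDiff_exp_neg_outputFreeEnergy ht).continuous.div_const _,
    fun _ => div_nonneg (exp_pos _).le (noiseNormalizer_pos ht).le, outputLaw_eq_withDensity ht⟩

lemma density_outputLaw (ht : 0 < t) :
    density (outputLaw μ t) = fun y =>
      rexp (-outputFreeEnergy μ t y) / noiseNormalizer (EuclideanSpace ℝ (Fin n)) t :=
  (isContDensity_outputLaw ht).density_eq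

theorem score_outputLaw (ht : 0 < t) (y : EuclideanSpace ℝ (Fin n)) :
    score (outputLaw μ t) y = -(t⁻¹ • noiseMean μ t y) := by
  have hlog : ∀ y, log (density (outputLaw μ t) y) =
      -outputFreeEnergy μ t y - log (noiseNormalizer (EuclideanSpace ℝ (Fin n)) t) := fun y => by
    rw [density_outputLaw ht, log_div (exp_ne_zero _) (noiseNormalizer_pos ht).ne', log_exp]
  simp only [score, hlog]
  refine HasGradientAt.gradient ?_
  have h := (hasGradientAt_outputFreeEnergy (μ := μ) ht y).hasFDerivAt
  rw [hasGradientAt_iff_hasFDerivAt, map_neg]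
  exact h.fun_neg.sub_const _

variable {Ω : Type*} [MeasurableSpace Ω] {P : Measure Ω} {X Y : Ω → EuclideanSpace ℝ (Fin n)}

namespace IsGaussianChannel

lemma isContDensity_density (h : IsGaussianChannel P X Y μ t) (ht : 0 < t) :
    IsContDensity (P.map Y) (density (P.map Y)) := by
  rw [h.map_output, density_outputLaw ht]
  exact isContDensity_outputLaw ht

lemma contDiff_density (h : IsGaussianChannel P X Y μ t) (ht : 0 < t) :
    ContDiff ℝ 1 (density (P.map Y)) := by
  rw [h.map_output, density_outputLaw ht]
  exact (contDiff_exp_neg_outputFreeEnergy ht).div_const _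

lemma density_pos (h : IsGaussianChannel P X Y μ t) (ht : 0 < t) (y : EuclideanSpace ℝ (Fin n)) :
    0 < density (P.map Y) y := by
  rw [h.map_output, density_outputLaw ht]
  exact div_pos (exp_pos _) (noiseNormalizer_pos ht)

theorem fisherInfo_eq (h : IsGaussianChannel P X Y μ t) (ht : 0 < t) :
    fisherInfo Y P = ENNReal.ofReal ((∫ y, ‖noiseMean μ t y‖ ^ 2 ∂outputLaw μ t) / t ^ 2) := by
  have hscore : ∀ y, ‖score (outputLaw μ t) y‖ ^ 2 = ‖noiseMean μ t y‖ ^ 2 / t ^ 2 := fun y => by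
    rw [score_outputLaw ht, norm_neg, norm_smul, norm_of_nonneg (inv_nonneg.2 ht.le), mul_pow,
      inv_pow, inv_mul_eq_div]
  rw [fisherInfo, h.map_output, lintegral_enorm_sq_eq_ofReal_integral]
  · simp only [hscore, integral_div]
  · simp only [hscore]
    exact ((memLp_noiseMean ht).integrable_norm_pow two_ne_zero).div_const _

lemma toReal_fisherInfo (h : IsGaussianChannel P X Y μ t) (ht : 0 < t) :
    (fisherInfo Y P).toReal = (∫ y, ‖noiseMean μ t y‖ ^ 2 ∂outputLaw μ t) / t ^ 2 := by
  rw [h.fisherInfo_eq ht, ENNReal.toReal_ofReal (by positivity)]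

theorem mmse_eq [IsFiniteMeasure P] (h : IsGaussianChannel P X Y μ t) (ht : 0 < t)
    (hX : Integrable X P) :
    mmse X Y P = ENNReal.ofReal (n * t - ∫ y, ‖noiseMean μ t y‖ ^ 2 ∂outputLaw μ t) := by
  have hm := measurable_noiseMean (μ := μ) ht.le
  calc mmse X Y P = ∫⁻ ω, ‖Y ω - X ω - noiseMean μ t (Y ω)‖ₑ ^ 2 ∂P := by
        refine lintegral_congr_ae ?_
        filter_upwards [h.condExp_ae_eq ht hX] with ω hω
        rw [hω, ← enorm_neg, neg_sub, sub_right_comm]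
    _ = ∫⁻ p, ‖p.2 - p.1 - noiseMean μ t p.2‖ₑ ^ 2 ∂channelLaw μ t := by
        rw [← h.map_prodMk, lintegral_map (by fun_prop)
          (h.measurable_input.prodMk h.measurable_output)]
    _ = ENNReal.ofReal (n * t - ∫ y, ‖noiseMean μ t y‖ ^ 2 ∂outputLaw μ t) := by
        rw [lintegral_enorm_sq_eq_ofReal_integral, integral_sq_norm_sub_noiseMean ht,
          finrank_euclideanSpace_fin]
        exact (memLp_sub_channelLaw.sub (memLp_noiseMean_snd ht)).integrable_norm_pow two_ne_zero

lemma toReal_mmse [IsFiniteMeasure P] (h : IsGaussianChannel P X Y μ t) (ht : 0 < t)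
    (hX : Integrable X P) :
    (mmse X Y P).toReal = n * t - ∫ y, ‖noiseMean μ t y‖ ^ 2 ∂outputLaw μ t := by
  have hnonneg : 0 ≤ ∫ p, ‖p.2 - p.1 - noiseMean μ t p.2‖ ^ 2 ∂channelLaw μ t := by positivity
  rw [integral_sq_norm_sub_noiseMean ht, finrank_euclideanSpace_fin] at hnonneg
  rw [h.mmse_eq ht hX, ENNReal.toReal_ofReal hnonneg]

end IsGaussianChannel

end FisherInformation

end

theorem mainTheorem3 {Ω : Type*} [MeasurableSpace Ω] (P : Measure Ω) [IsProbabilityMeasure P]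
    (n : ℕ) (X : Ω → EuclideanSpace ℝ (Fin n)) (hX : Measurable X)
    (Z : ℝ → Ω → EuclideanSpace ℝ (Fin n)) (hZ : ∀ t, 0 < t → Measurable (Z t))
    (hZlaw : ∀ t, 0 < t →
      P.map (Z t) = multivariateGaussian 0 (t • (1 : Matrix (Fin n) (Fin n) ℝ)))
    (hind : ∀ t, 0 < t → IndepFun X (Z t) P)
    (Y : ℝ → Ω → EuclideanSpace ℝ (Fin n)) (hY : ∀ t ω, Y t ω = X ω + Z t ω) :
    -- the density of `Y t` is well defined, positive and C¹, and the Fisher information finite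
    (∀ t, 0 < t → IsContDensity (P.map (Y t)) (density (P.map (Y t))) ∧
      ContDiff ℝ 1 (density (P.map (Y t))) ∧ (∀ y, 0 < density (P.map (Y t)) y) ∧
      fisherInfo (Y t) P ≠ ⊤) ∧
    -- the relation between mutual information and Fisher information
    ((∃ t₀, 0 < t₀ ∧ mutualInfo X (Y t₀) P ≠ ⊤) → ∀ t, 0 < t →
      mutualInfo X (Y t) P ≠ ⊤ ∧
      HasDerivAt (fun s => (mutualInfo X (Y s) P).toReal)
        ((fisherInfo (Y t) P).toReal / 2 - n / (2 * t)) t) ∧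
    -- integrable inputs: finite mutual information, and the MMSE-Fisher relation
    (Integrable X P → ∀ t, 0 < t →
      mutualInfo X (Y t) P ≠ ⊤ ∧ mmse X (Y t) P ≠ ⊤ ∧
      (mmse X (Y t) P).toReal = n * t - t ^ 2 * (fisherInfo (Y t) P).toReal) := by
  have hμ : IsProbabilityMeasure (P.map X) := Measure.isProbabilityMeasure_map hX.aemeasurable
  have hchannel : ∀ t, 0 < t → IsGaussianChannel P X (Y t) (P.map X) t := fun t ht =>
    isGaussianChannel_of_indepFun hX (hZ t ht)
      ((hZlaw t ht).trans (multivariateGaussian_zero_smul_one ht.le)) (hind t ht) (hY t)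
  refine ⟨fun t ht => ?_, ?_, fun hXint t ht => ?_⟩
  · have h := hchannel t ht
    exact ⟨h.isContDensity_density ht, h.contDiff_density ht, h.density_pos ht,
      h.fisherInfo_eq ht ▸ ENNReal.ofReal_ne_top⟩
  · rintro ⟨t₀, ht₀, hI₀⟩ t ht
    have hF₀ := ((hchannel t₀ ht₀).mutualInfo_ne_top_iff ht₀).1 hI₀
    have hI := ((hchannel t ht).mutualInfo_ne_top_iff ht).2 (integrable_outputFreeEnergy ht₀ ht hF₀)
    refine ⟨hI, (IsGaussianChannel.hasDerivAt_mutualInfo hchannel ht hI).congr_deriv ?_⟩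
    rw [(hchannel t ht).toReal_fisherInfo ht, finrank_euclideanSpace_fin]
    field_simp
  · have h := hchannel t ht
    refine ⟨h.mutualInfo_ne_top_of_integrable ht hXint, ?_, ?_⟩
    · exact h.mmse_eq ht hXint ▸ ENNReal.ofReal_ne_top
    · rw [h.toReal_mmse ht hXint, h.toReal_fisherInfo ht]
      field_simp
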